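/- Let $\mathcal H$ be a separable complex Hilbert space and $\mathcal K=L^2(\mathbb R,\mathcal H,dt)$. A \emph{propagator} is a family of unitary operators $U(t,s)$, $t,s\in\mathbb R$, on $\mathcal H$ that is jointly strongly continuous in $(t,s)$ and satisfies $U(t,r)U(r,s)=U(t,s)$ for all $t,r,s$. Its \emph{quasi-energy operator} $K$ is the self-adjoint generator of the one-parameter unitary group on $\mathcal K$ given by $(e^{-i\sigma K}f)(t)=U(t,t-\sigma)f(t-\sigma)$. Let $-i\partial_t$ be the operator in $\mathcal K$ whose domain consists of the $f\in\mathcal K$ that are absolutely continuous on every compact interval with $f'\in L^2$. For a family $H(t)$, $t\in\mathbb R$, of self-adjoint operators in $\mathcal H$ let $\mathfrak H=\int_{\mathbb R}^{\oplus}H(t)\,dt$, i.e. $(\mathfrak Hf)(t)=H(t)f(t)$ with domain the set of all $f\in\mathcal K$ such that $f(t)\in\operatorname{Dom}H(t)$ for almost every $t$ and $t\mapsto H(t)f(t)$ belongs to $L^2(\mathbb R,\mathcal H,dt)$. The propagator $U(t,s)$ is \emph{weakly associated} to $H(t)$ if $\operatorname{Dom}(-i\partial_t)\cap\operatorname{Dom}\mathfrak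 H$ is dense in $\mathcal K$ and $K=\overline{-i\partial_t+\mathfrak H}$. \textbf{Proposition.} Let $V(t)$, $t\in\mathbb R$, be a family of unitary operators on $\mathcal H$ that is continuously differentiable in the strong sense (for every $\psi\in\mathcal H$ the map $t\mapsto V(t)\psi$ is $C^1$), with strong derivative $\dot V(t)$. Let $\tilde H(t)$, $t\in\mathbb R$, be a family of self-adjoint operators in $\mathcal H$ with $\operatorname{Dom}\tilde H(t)=D$ for all $t\in\mathbb R$, and set $$H(t)=V(t)\tilde H(t)V(t)^{-1}+i\dot V(t)V(t)^{-1},\qquad \operatorname{Dom}H(t)=V(t)D .$$ If a propagator $\tilde U(t,s)$ is weakly associated to $\tilde H(t)$, then every $H(t)$ is self-adjoint, $U(t,s)=V(t)\tilde U(t,s)V(s)^{-1}$ is a propagator, and $U(t,s)$ is weakly associated to $H(t)$. -/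

import Mathlib

open MeasureTheory Filter Topology

noncomputable section

/-- The Hilbert space `𝒦 = L²(ℝ, 𝓗, dt)`. -/
abbrev TimeL2 (E : Type*) [NormedAddCommGroup E] : Type _ :=
  Lp E 2 (volume : Measure ℝ)

/-- A function is absolutely continuous on `ℝ` if it is so on every compact interval. -/
def LocallyAC {E : Type*} [NormedAddCommGroup E] (φ : ℝ → E) : Prop :=
  ∀ a b : ℝ, AbsolutelyContinuousOnInterval φ a b

theorem LocallyAC.continuous {E : Type*} [NormedAddCommGroup E] {φ : ℝ → E}
    (h : LocallyAC φ) : Continuous φ := by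
  rw [continuous_iff_continuousAt]
  intro x
  have hx := (h (x - 1) (x + 1)).continuousOn
  refine hx.continuousAt ?_
  rw [Set.uIcc_of_le (by linarith)]
  exact Icc_mem_nhds (by linarith) (by linarith)

section Operators

variable {E : Type*} [NormedAddCommGroup E] [InnerProductSpace ℂ E]

/-- The graph of `-i ∂ₜ` in `𝒦`: the pairs `(f, -i f')` where `f ∈ L²` has an absolutely continuous
representative `φ` whose derivative exists almost everywhere and is the element `f'` of `L²`. -/
def momentumGraph (E : Type*) [NormedAddCommGroup E] [InnerProductSpace ℂ E] :
    Submodule ℂ (TimeL2 E × TimeL2 E) where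
  carrier := {p | ∃ (φ : ℝ → E) (f' : TimeL2 E), p.1 =ᵐ[volume] φ ∧ LocallyAC φ ∧
    (∀ᵐ t : ℝ, HasDerivAt φ (f' t) t) ∧ p.2 = (-Complex.I) • f'}
  zero_mem' := by
    refine ⟨fun _ => 0, 0, Lp.coeFn_zero _ _ _, ?_, ?_, by simp⟩
    · intro a b
      have h : LipschitzOnWith 0 (fun _ : ℝ => (0 : E)) (Set.uIcc a b) :=
        LipschitzWith.lipschitzOnWith (LipschitzWith.const 0)
      exact h.absolutelyContinuousOnInterval
    · filter_upwards [Lp.coeFn_zero E 2 (volume : Measure ℝ)] with t ht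
      rw [ht]
      exact hasDerivAt_const t 0
  add_mem' := by
    rintro p q ⟨φ, f, h1, h2, h3, h4⟩ ⟨ψ, g, k1, k2, k3, k4⟩
    refine ⟨φ + ψ, f + g, ?_, fun a b => (h2 a b).add (k2 a b), ?_, ?_⟩
    · exact (Lp.coeFn_add _ _).trans (h1.add k1)
    · filter_upwards [h3, k3, Lp.coeFn_add f g] with t ht kt hfg
      rw [hfg]
      exact ht.add kt
    · simp [h4, k4]
  smul_mem' := by
    rintro c p ⟨φ, f, h1, h2, h3, h4⟩
    refine ⟨c • φ, c • f, ?_, fun a b => (h2 a b).const_smul c, ?_, ?_⟩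
    · exact (Lp.coeFn_smul _ _).trans (h1.const_smul c)
    · filter_upwards [h3, Lp.coeFn_smul c f] with t ht hf
      rw [hf]
      exact ht.const_smul c
    · rw [Prod.smul_snd, h4, smul_comm]

theorem momentumGraph_snd_eq_zero (p : TimeL2 E × TimeL2 E) (hp : p ∈ momentumGraph E)
    (h0 : p.1 = 0) : p.2 = 0 := by
  obtain ⟨φ, f, h1, h2, h3, h4⟩ := hp
  have hφ : φ = fun _ => 0 := by
    refine (Continuous.ae_eq_iff_eq (μ := (volume : Measure ℝ)) h2.continuous
      continuous_const).1 ?_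
    refine h1.symm.trans ?_
    rw [h0]
    exact Lp.coeFn_zero _ _ _
  have hf : f = 0 := by
    rw [Lp.eq_zero_iff_ae_eq_zero]
    filter_upwards [h3] with t ht
    rw [hφ] at ht
    exact ht.unique (hasDerivAt_const t 0)
  rw [h4, hf, smul_zero]

/-- The operator `-i ∂ₜ` in `𝒦 = L²(ℝ, 𝓗, dt)`. -/
def momentum (E : Type*) [NormedAddCommGroup E] [InnerProductSpace ℂ E] :
    TimeL2 E →ₗ.[ℂ] TimeL2 E :=
  (momentumGraph E).toLinearPMap

theorem momentum_graph : (momentum E).graph = momentumGraph E :=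
  Submodule.toLinearPMap_graph_eq _ momentumGraph_snd_eq_zero

/-- The graph of the direct integral of a family of operators: the pairs `(f, g)` of elements
of `L²` such that `f t ∈ Dom (A t)` and `g t = A t (f t)` for almost all `t`. -/
def directIntegralGraph (A : ℝ → E →ₗ.[ℂ] E) : Submodule ℂ (TimeL2 E × TimeL2 E) where
  carrier := {p | ∀ᵐ t : ℝ, (p.1 t, p.2 t) ∈ (A t).graph}
  zero_mem' := by
    filter_upwards [Lp.coeFn_zero E 2 (volume : Measure ℝ)] with t ht
    simp only [Prod.fst_zero, Prod.snd_zero, ht]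
    exact (A t).graph.zero_mem
  add_mem' := by
    rintro p q hp hq
    filter_upwards [hp, hq, Lp.coeFn_add p.1 q.1, Lp.coeFn_add p.2 q.2] with t h k e1 e2
    simp only [Prod.fst_add, Prod.snd_add, e1, e2]
    exact (A t).graph.add_mem h k
  smul_mem' := by
    rintro c p hp
    filter_upwards [hp, Lp.coeFn_smul c p.1, Lp.coeFn_smul c p.2] with t h e1 e2
    simp only [Prod.smul_fst, Prod.smul_snd, e1, e2]
    exact (A t).graph.smul_mem c h

theorem directIntegralGraph_snd_eq_zero (A : ℝ → E →ₗ.[ℂ] E) (p : TimeL2 E × TimeL2 E)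
    (hp : p ∈ directIntegralGraph A) (h0 : p.1 = 0) : p.2 = 0 := by
  rw [Lp.eq_zero_iff_ae_eq_zero]
  filter_upwards [hp, Lp.coeFn_zero E 2 (volume : Measure ℝ)] with t h e
  exact LinearPMap.graph_fst_eq_zero_snd (A t) h (by rw [h0, e]; rfl)

/-- The direct integral `∫^⊕ A(t) dt`, as an operator in `𝒦`: its domain consists of the `f ∈ 𝒦`
with `f t ∈ Dom (A t)` for almost all `t` and `t ↦ A t (f t)` in `L²`. -/
def directIntegral (A : ℝ → E →ₗ.[ℂ] E) : TimeL2 E →ₗ.[ℂ] TimeL2 E :=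
  (directIntegralGraph A).toLinearPMap

theorem directIntegral_graph (A : ℝ → E →ₗ.[ℂ] E) :
    (directIntegral A).graph = directIntegralGraph A :=
  Submodule.toLinearPMap_graph_eq _ (directIntegralGraph_snd_eq_zero A)

/-- The generator `K` of a one-parameter family `T σ = exp (-i σ K)`: its domain consists of the
vectors `f` for which `σ ↦ T σ f` is differentiable at `σ = 0`, and `K f = i (d/dσ) T σ f` there. -/
def stoneGenerator {F : Type*} [NormedAddCommGroup F] [InnerProductSpace ℂ F]
    (T : ℝ → F →ₗ[ℂ] F) : F →ₗ.[ℂ] F where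
  domain :=
    { carrier := {f | DifferentiableAt ℝ (fun σ => T σ f) 0}
      zero_mem' := by simp
      add_mem' := by
        intro f g hf hg
        simp only [Set.mem_ofPred_eq, map_add] at *
        exact hf.add hg
      smul_mem' := by
        intro c f hf
        simp only [Set.mem_ofPred_eq, map_smul] at *
        exact hf.const_smul c }
  toFun :=
    { toFun := fun f => Complex.I • deriv (fun σ => T σ (f : F)) 0
      map_add' := by
        rintro ⟨f, hf⟩ ⟨g, hg⟩
        simp only [Submodule.coe_add, map_add]
        rw [← smul_add]
        congr 1
        exact deriv_add hf hg
      map_smul' := by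
        rintro c ⟨f, hf⟩
        simp only [Submodule.coe_smul, map_smul, RingHom.id_apply]
        rw [smul_comm c]
        congr 1
        exact deriv_const_smul c hf }

/-- The operator `V A V⁻¹` with domain `V (Dom A)`, for `V` unitary. -/
def unitaryConj (V : E ≃ₗᵢ[ℂ] E) (A : E →ₗ.[ℂ] E) : E →ₗ.[ℂ] E where
  domain := A.domain.comap (V.symm.toLinearEquiv : E →ₗ[ℂ] E)
  toFun :=
    { toFun := fun x => V (A ⟨V.symm x, x.2⟩)
      map_add' := by
        intro x y
        rw [← map_add, ← LinearPMap.map_add]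
        congr 2
        ext
        exact map_add V.symm (x : E) (y : E)
      map_smul' := by
        intro c x
        rw [RingHom.id_apply, ← map_smul, ← LinearPMap.map_smul]
        congr 2
        ext
        exact map_smul V.symm c (x : E) }

/-- `V(t)` is continuously differentiable in the strong sense. -/
def StronglyC1 (V : ℝ → E ≃ₗᵢ[ℂ] E) : Prop :=
  ∀ ψ : E, ContDiff ℝ 1 (fun t => V t ψ)

/-- The strong derivative `V̇(t)`. -/
def strongDeriv (V : ℝ → E ≃ₗᵢ[ℂ] E) (hV : StronglyC1 V) (t : ℝ) : E →ₗ[ℂ] E where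
  toFun ψ := deriv (fun s => V s ψ) t
  map_add' ψ χ := by
    simp only [map_add]
    exact deriv_add ((hV ψ).differentiable one_ne_zero t) ((hV χ).differentiable one_ne_zero t)
  map_smul' c ψ := by
    simp only [map_smul, RingHom.id_apply]
    exact deriv_const_smul c ((hV ψ).differentiable one_ne_zero t)

/-- The family `V(t) A(t) V(t)⁻¹ + i V̇(t) V(t)⁻¹`, with domain `V(t) (Dom A(t))`
(the second summand is defined everywhere). -/
def transformedHamiltonian (V : ℝ → E ≃ₗᵢ[ℂ] E) (hV : StronglyC1 V) (A : ℝ → E →ₗ.[ℂ] E)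
    (t : ℝ) : E →ₗ.[ℂ] E :=
  (Complex.I • (strongDeriv V hV t ∘ₗ ((V t).symm.toLinearEquiv : E →ₗ[ℂ] E))) +ᵥ
    unitaryConj (V t) (A t)

end Operators

/-- A propagator: a family of unitary operators `U(t,s)` that is strongly continuous jointly in
`t, s` and satisfies the Chapman-Kolmogorov equality. -/
structure Propagator (E : Type*) [NormedAddCommGroup E] [InnerProductSpace ℂ E] where
  /-- The unitary operator `U(t,s)`. -/
  op : ℝ → ℝ → E ≃ₗᵢ[ℂ] E
  continuous_op : ∀ ψ : E, Continuous fun p : ℝ × ℝ => op p.1 p.2 ψ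
  chapman : ∀ (t s r : ℝ) (ψ : E), op t r (op r s ψ) = op t s ψ

section QuasiEnergy

variable {E : Type*} [NormedAddCommGroup E] [InnerProductSpace ℂ E]

theorem continuous_uncurry_of_strong {W : ℝ → E ≃ₗᵢ[ℂ] E}
    (hW : ∀ ψ : E, Continuous fun t => W t ψ) : Continuous fun p : ℝ × E => W p.1 p.2 := by
  rw [continuous_iff_continuousAt]
  rintro ⟨t, ψ⟩
  rw [ContinuousAt, tendsto_iff_norm_sub_tendsto_zero]
  have h1 : Tendsto (fun p : ℝ × E => ‖p.2 - ψ‖ + ‖W p.1 ψ - W t ψ‖) (𝓝 (t, ψ)) (𝓝 0) := by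
    have : Continuous fun p : ℝ × E => ‖p.2 - ψ‖ + ‖W p.1 ψ - W t ψ‖ := by
      have := (hW ψ).comp (continuous_fst (X := ℝ) (Y := E))
      simp only [Function.comp_def] at this
      fun_prop
    simpa using this.tendsto (t, ψ)
  refine squeeze_zero (fun _ => norm_nonneg _) (fun p => ?_) h1
  have h2 : W p.1 p.2 - W t ψ = W p.1 (p.2 - ψ) + (W p.1 ψ - W t ψ) := by
    rw [map_sub]; abel
  rw [h2]
  exact (norm_add_le _ _).trans (by rw [LinearIsometryEquiv.norm_map])

theorem memLp_strong {W : ℝ → E ≃ₗᵢ[ℂ] E} (hW : ∀ ψ : E, Continuous fun t => W t ψ)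
    {f : ℝ → E} (hf : MemLp f 2 volume) : MemLp (fun t => W t (f t)) 2 volume := by
  refine MemLp.of_le hf ?_ (Eventually.of_forall fun t => by simp)
  exact (continuous_uncurry_of_strong hW).comp_aestronglyMeasurable
    (aestronglyMeasurable_id.prodMk hf.1)

/-- The function `t ↦ U(t, t-σ) f(t-σ)` is square integrable if `f` is. -/
theorem Propagator.memLp_shift (U : Propagator E) (σ : ℝ) (f : TimeL2 E) :
    MemLp (fun t => U.op t (t - σ) (f (t - σ))) 2 volume := by
  have h := (Lp.memLp f).comp_measurePreserving
    (measurePreserving_sub_right (volume : Measure ℝ) σ)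
  refine memLp_strong (W := fun t => U.op t (t - σ)) (fun ψ => ?_) h
  exact (U.continuous_op ψ).comp (by fun_prop : Continuous fun t : ℝ => (t, t - σ))

/-- The one-parameter group `(exp (-i σ K) f)(t) = U(t, t-σ) f(t-σ)` in `𝒦`. -/
def Propagator.evolutionGroup (U : Propagator E) (σ : ℝ) : TimeL2 E →ₗ[ℂ] TimeL2 E where
  toFun f := (U.memLp_shift σ f).toLp _
  map_add' f g := by
    rw [← MemLp.toLp_add, MemLp.toLp_eq_toLp_iff]
    have h := (measurePreserving_sub_right (volume : Measure ℝ) σ).quasiMeasurePreserving.ae_eq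
      (Lp.coeFn_add f g)
    filter_upwards [h] with t ht
    simp only [Function.comp_apply, Pi.add_apply] at ht ⊢
    rw [ht, map_add]
  map_smul' c f := by
    rw [RingHom.id_apply, ← MemLp.toLp_const_smul, MemLp.toLp_eq_toLp_iff]
    have h := (measurePreserving_sub_right (volume : Measure ℝ) σ).quasiMeasurePreserving.ae_eq
      (Lp.coeFn_smul c f)
    filter_upwards [h] with t ht
    simp only [Function.comp_apply, Pi.smul_apply] at ht ⊢
    rw [ht, map_smul]

/-- The quasi-energy operator of a propagator. -/
def Propagator.quasiEnergy (U : Propagator E) : TimeL2 E →ₗ.[ℂ] TimeL2 E :=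
  stoneGenerator U.evolutionGroup

/-- `U` is weakly associated to the family `A(t)`: with `𝔄 = ∫^⊕ A(t) dt`, the intersection
`Dom (-i ∂ₜ) ∩ Dom 𝔄`, which is the domain of the sum, is dense in `𝒦`, and the quasi-energy
operator is the closure of `-i ∂ₜ + 𝔄`. -/
def WeaklyAssociated (U : Propagator E) (A : ℝ → E →ₗ.[ℂ] E) : Prop :=
  Dense ((momentum E + directIntegral A).domain : Set (TimeL2 E)) ∧
    U.quasiEnergy = (momentum E + directIntegral A).closure

end QuasiEnergy

end

/-! Multiplication by `V(t)` is a unitary `M` on `𝒦` that intertwines the two evolution groups, so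
the quasi-energy operators satisfy `K_U = M K_Ũ M⁻¹`. By the product rule, `M` also formally
conjugates `-i∂ₜ + ∫^⊕ H̃` into `-i∂ₜ + ∫^⊕ H`: the term `-iV̇` coming from `-i∂ₜ` cancels the added
`iV̇V⁻¹`.

The obstacle is domains: `V̇` is bounded only locally in time (by uniform boundedness), so `V̇f`
need not lie in `L²` and `M` need not preserve `Dom(-i∂ₜ)`. Time cutoffs repair this. A cut-off
vector is mapped into the right domain (`exists_mem_graph_cutoff`), and removing the cutoff puts the
image of one graph in the closure of the other (`strongMul_mem_closure_graph`). The same applied to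
`V⁻¹` gives the reverse inclusion, so the closed graphs correspond under `M`.

Self-adjointness of `H(t)` is a separate computation with adjoint graphs: unitarity of `V` makes
`iV̇V⁻¹` symmetric, and it is everywhere defined. -/

noncomputable section

/-! ### Strongly continuous and strongly `C¹` unitary families -/

section StrongFamilies

variable {E : Type*} [NormedAddCommGroup E] [InnerProductSpace ℂ E]

/-- A strongly continuous family of isometries is jointly continuous in parameter and vector. -/
theorem continuous_eval_of_strong {X : Type*} [TopologicalSpace X] {W : X → E ≃ₗᵢ[ℂ] E}
    (hW : ∀ ψ : E, Continuous fun t => W t ψ) : Continuous fun p : X × E => W p.1 p.2 := by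
  rw [continuous_iff_continuousAt]
  rintro ⟨t, ψ⟩
  rw [ContinuousAt, tendsto_iff_norm_sub_tendsto_zero]
  have h1 : Tendsto (fun p : X × E => ‖p.2 - ψ‖ + ‖W p.1 ψ - W t ψ‖) (𝓝 (t, ψ)) (𝓝 0) := by
    have : Continuous fun p : X × E => ‖p.2 - ψ‖ + ‖W p.1 ψ - W t ψ‖ := by
      have := (hW ψ).comp (continuous_fst (X := X) (Y := E))
      simp only [Function.comp_def] at this
      fun_prop
    simpa using this.tendsto (t, ψ)
  refine squeeze_zero (fun _ => norm_nonneg _) (fun p => ?_) h1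
  have h2 : W p.1 p.2 - W t ψ = W p.1 (p.2 - ψ) + (W p.1 ψ - W t ψ) := by
    rw [map_sub]; abel
  rw [h2]
  exact (norm_add_le _ _).trans (by rw [LinearIsometryEquiv.norm_map])

/-- Applying the isometry `W s` turns the increment of the inverses at `ψ` into an increment of `W`
at the fixed vector `(W t)⁻¹ψ`. -/
theorem continuous_symm_of_strong {X : Type*} [TopologicalSpace X] {W : X → E ≃ₗᵢ[ℂ] E}
    (hW : ∀ ψ : E, Continuous fun t => W t ψ) (ψ : E) : Continuous fun t => (W t).symm ψ := by
  rw [continuous_iff_continuousAt]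
  intro t
  rw [ContinuousAt, tendsto_iff_norm_sub_tendsto_zero]
  have h : Tendsto (fun s => ‖W t ((W t).symm ψ) - W s ((W t).symm ψ)‖) (𝓝 t) (𝓝 0) := by
    have : Continuous fun s => ‖W t ((W t).symm ψ) - W s ((W t).symm ψ)‖ :=
      (continuous_const.sub (hW _)).norm
    simpa using this.tendsto t
  refine h.congr fun s => ?_
  rw [← (W s).norm_map ((W s).symm ψ - _), map_sub, LinearIsometryEquiv.apply_symm_apply,
    LinearIsometryEquiv.apply_symm_apply]

variable {V : ℝ → E ≃ₗᵢ[ℂ] E}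

theorem StronglyC1.continuous (hV : StronglyC1 V) (ψ : E) : Continuous fun t => V t ψ :=
  ContDiff.continuous (hV ψ)

theorem StronglyC1.hasDerivAt (hV : StronglyC1 V) (ψ : E) (t : ℝ) :
    HasDerivAt (fun s => V s ψ) (strongDeriv V hV t ψ) t :=
  ((hV ψ).differentiable one_ne_zero t).hasDerivAt

theorem StronglyC1.continuous_strongDeriv (hV : StronglyC1 V) (ψ : E) :
    Continuous fun t => strongDeriv V hV t ψ :=
  (contDiff_one_iff_deriv.1 (hV ψ)).2

/-- A strongly `C¹` family is Lipschitz in operator norm on compact intervals. -/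
theorem StronglyC1.exists_lipschitz [CompleteSpace E] (hV : StronglyC1 V) (a b : ℝ) :
    ∃ M : ℝ, 0 ≤ M ∧ ∀ s ∈ Set.Icc a b, ∀ t ∈ Set.Icc a b, ∀ ψ : E,
      ‖V t ψ - V s ψ‖ ≤ M * |t - s| * ‖ψ‖ := by
  -- Difference quotients, zero on the diagonal because `0⁻¹ = 0`. Each orbit is `C¹`, hence
  -- Lipschitz on the compact interval, so they are pointwise bounded and Banach–Steinhaus applies.
  let G : Set.Icc a b × Set.Icc a b → E →L[ℂ] E := fun p =>
    ((((p.2 : ℝ) - p.1)⁻¹ : ℝ) : ℂ) • (((V p.2).toContinuousLinearEquiv : E →L[ℂ] E) -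
      ((V p.1).toContinuousLinearEquiv : E →L[ℂ] E))
  have hG : ∀ p ψ, G p ψ = ((((p.2 : ℝ) - p.1)⁻¹ : ℝ) : ℂ) • (V p.2 ψ - V p.1 ψ) :=
    fun p ψ => rfl
  obtain ⟨M, hM⟩ : ∃ M, ∀ p, ‖G p‖ ≤ M := by
    refine banach_steinhaus fun ψ => ?_
    obtain ⟨K, hK⟩ := (hV ψ).contDiffOn.exists_lipschitzOnWith (by decide) (convex_Icc a b)
      isCompact_Icc
    refine ⟨K, fun p => ?_⟩
    have h := hK.norm_sub_le p.2.2 p.1.2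
    rw [hG, norm_smul, Complex.norm_real, norm_inv]
    refine (mul_le_mul_of_nonneg_left h (by positivity)).trans ?_
    rw [mul_left_comm]
    exact mul_le_of_le_one_right K.2 (inv_mul_le_one (a := ‖(p.2 : ℝ) - p.1‖))
  -- The interval may be empty, so `M` itself carries no sign.
  refine ⟨max M 0, le_max_right _ _, fun s hs t ht ψ => ?_⟩
  rcases eq_or_ne t s with rfl | hts
  · simp
  have h1 : V t ψ - V s ψ = ((t - s : ℝ) : ℂ) • G (⟨s, hs⟩, ⟨t, ht⟩) ψ := by
    rw [hG, smul_smul, ← Complex.ofReal_mul, mul_inv_cancel₀ (sub_ne_zero.2 hts),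
      Complex.ofReal_one, one_smul]
  rw [h1, norm_smul, Complex.norm_real, Real.norm_eq_abs]
  have h2 := (G (⟨s, hs⟩, ⟨t, ht⟩)).le_of_opNorm_le ((hM _).trans (le_max_left M 0)) ψ
  calc |t - s| * ‖G (⟨s, hs⟩, ⟨t, ht⟩) ψ‖ ≤ |t - s| * (max M 0 * ‖ψ‖) := by gcongr
    _ = _ := by ring

theorem StronglyC1.exists_bound_strongDeriv [CompleteSpace E] (hV : StronglyC1 V) (t₀ : ℝ) :
    ∃ M : ℝ, ∀ᶠ t in 𝓝 t₀, ∀ ψ : E, ‖strongDeriv V hV t ψ‖ ≤ M * ‖ψ‖ := by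
  obtain ⟨M, hM0, hM⟩ := hV.exists_lipschitz (t₀ - 1) (t₀ + 1)
  refine ⟨M, ?_⟩
  filter_upwards [Ioo_mem_nhds (sub_one_lt t₀) (lt_add_one t₀)] with t ht ψ
  refine (hV.hasDerivAt ψ t).le_of_lip' (by positivity) ?_
  filter_upwards [Ioo_mem_nhds ht.1 ht.2] with s hs
  have := hM t (Set.Ioo_subset_Icc_self ht) s (Set.Ioo_subset_Icc_self hs) ψ
  rwa [mul_right_comm] at this

/-- `V̇(t)` is not isometric; the locally uniform operator bound takes over the role of the isometry
in the estimate. -/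
theorem StronglyC1.continuous_eval_strongDeriv [CompleteSpace E] (hV : StronglyC1 V) :
    Continuous fun p : ℝ × E => strongDeriv V hV p.1 p.2 := by
  rw [continuous_iff_continuousAt]
  rintro ⟨t, ψ⟩
  obtain ⟨M, hM⟩ := hV.exists_bound_strongDeriv t
  rw [ContinuousAt, tendsto_iff_norm_sub_tendsto_zero]
  have h1 : Tendsto (fun p : ℝ × E => M * ‖p.2 - ψ‖ +
      ‖strongDeriv V hV p.1 ψ - strongDeriv V hV t ψ‖) (𝓝 (t, ψ)) (𝓝 0) := by
    have : Continuous fun p : ℝ × E => M * ‖p.2 - ψ‖ +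
        ‖strongDeriv V hV p.1 ψ - strongDeriv V hV t ψ‖ := by
      have := (hV.continuous_strongDeriv ψ).comp (continuous_fst (X := ℝ) (Y := E))
      simp only [Function.comp_def] at this
      fun_prop
    simpa using this.tendsto (t, ψ)
  refine squeeze_zero' (Eventually.of_forall fun _ => norm_nonneg _) ?_ h1
  filter_upwards [(continuous_fst.tendsto (t, ψ)).eventually hM] with p hp
  have h2 : strongDeriv V hV p.1 p.2 - strongDeriv V hV t ψ = strongDeriv V hV p.1 (p.2 - ψ) +
      (strongDeriv V hV p.1 ψ - strongDeriv V hV t ψ) := by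
    rw [map_sub]; abel
  rw [h2]
  exact (norm_add_le _ _).trans (add_le_add_left (hp _) _)

/-- The product rule for a strongly differentiable family of isometries applied to a curve. -/
theorem hasDerivAt_strong_apply {W : ℝ → E ≃ₗᵢ[ℂ] E} (hW : ∀ ψ : E, Continuous fun t => W t ψ)
    {φ : ℝ → E} {φ' χ : E} {t : ℝ} (hφ : HasDerivAt φ φ' t)
    (h : HasDerivAt (fun s => W s (φ t)) χ t) :
    HasDerivAt (fun s => W s (φ s)) (W t φ' + χ) t := by
  rw [hasDerivAt_iff_tendsto_slope] at *
  have h1 : Tendsto (fun s => W s (slope φ t s)) (𝓝[≠] t) (𝓝 (W t φ')) :=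
    ((continuous_uncurry_of_strong hW).tendsto (t, φ')).comp
      ((tendsto_id.mono_left nhdsWithin_le_nhds).prodMk_nhds hφ)
  refine (h1.add h).congr fun s => ?_
  simp only [slope_def_module, ← Complex.coe_smul, map_smul, map_sub, ← smul_add]
  congr 1
  abel

/-- With `χ₀ = (W t)⁻¹ψ`, the increment of the inverse is `-(W s)⁻¹(W s χ₀ - W t χ₀)`; joint
continuity of `(W s)⁻¹` passes to the limit. -/
theorem hasDerivAt_symm_of_strong {W : ℝ → E ≃ₗᵢ[ℂ] E} (hW : ∀ ψ : E, Continuous fun t => W t ψ)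
    {ψ χ : E} {t : ℝ} (h : HasDerivAt (fun s => W s ((W t).symm ψ)) χ t) :
    HasDerivAt (fun s => (W s).symm ψ) (-(W t).symm χ) t := by
  rw [hasDerivAt_iff_tendsto_slope] at *
  have h1 : Tendsto (fun s => (W s).symm (slope (fun s => W s ((W t).symm ψ)) t s)) (𝓝[≠] t)
      (𝓝 ((W t).symm χ)) :=
    ((continuous_eval_of_strong (W := fun s => (W s).symm)
      (continuous_symm_of_strong hW)).tendsto (t, χ)).comp
      ((tendsto_id.mono_left nhdsWithin_le_nhds).prodMk_nhds h)
  refine h1.neg.congr fun s => ?_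
  simp only [slope_def_module, ← Complex.coe_smul, map_smul, map_sub, ← smul_neg]
  congr 1
  simp

theorem StronglyC1.hasDerivAt_symm (hV : StronglyC1 V) (ψ : E) (t : ℝ) :
    HasDerivAt (fun s => (V s).symm ψ) (-(V t).symm (strongDeriv V hV t ((V t).symm ψ))) t :=
  hasDerivAt_symm_of_strong hV.continuous (hV.hasDerivAt _ t)

theorem StronglyC1.symm [CompleteSpace E] (hV : StronglyC1 V) :
    StronglyC1 fun t => (V t).symm := by
  intro ψ
  rw [contDiff_one_iff_deriv]
  refine ⟨fun t => (hV.hasDerivAt_symm ψ t).differentiableAt, ?_⟩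
  have h : deriv (fun s => (V s).symm ψ) =
      fun t => -(V t).symm (strongDeriv V hV t ((V t).symm ψ)) :=
    funext fun t => (hV.hasDerivAt_symm ψ t).deriv
  rw [h]
  have h1 : Continuous fun t => (V t).symm ψ := continuous_symm_of_strong hV.continuous ψ
  have h2 := hV.continuous_eval_strongDeriv.comp (continuous_id.prodMk h1)
  exact ((continuous_eval_of_strong (W := fun s => (V s).symm)
    (continuous_symm_of_strong hV.continuous)).comp (continuous_id.prodMk h2)).neg

theorem StronglyC1.strongDeriv_symm (hV : StronglyC1 V) (hW : StronglyC1 fun t => (V t).symm)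
    (t : ℝ) (ψ : E) : strongDeriv (fun t => (V t).symm) hW t ψ =
      -(V t).symm (strongDeriv V hV t ((V t).symm ψ)) :=
  (hV.hasDerivAt_symm ψ t).deriv

theorem StronglyC1.locallyAC_apply [CompleteSpace E] (hV : StronglyC1 V) {φ : ℝ → E}
    (hφ : LocallyAC φ) : LocallyAC fun t => V t (φ t) := by
  intro a b
  obtain ⟨M, hM0, hM⟩ := hV.exists_lipschitz (min a b) (max a b)
  obtain ⟨B, hB⟩ := (hφ a b).exists_bound
  -- Splitting the increment as `V_t(φ_t - φ_s) + (V_t - V_s)φ_s`, the second term is at most `M B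
  -- |t - s|`, an increment of this linear function.
  have hlin : AbsolutelyContinuousOnInterval (fun t : ℝ => (M * B) * t) a b :=
    ContDiffOn.absolutelyContinuousOnInterval (by fun_prop)
  refine squeeze_zero' (Eventually.of_forall fun p => Finset.sum_nonneg fun i _ => dist_nonneg) ?_
    (by simpa using Tendsto.add (hφ a b) hlin)
  filter_upwards [mem_inf_of_right (mem_principal_self _)] with p hp
  rw [← Finset.sum_add_distrib]
  refine Finset.sum_le_sum fun i hi => ?_
  obtain ⟨h1, h2⟩ := hp.1 i hi
  have h3 := hM _ h2 _ h1 (φ (p.2 i).2)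
  have h4 := hB _ h2
  have h5 : V (p.2 i).1 (φ (p.2 i).1) - V (p.2 i).2 (φ (p.2 i).2) =
      V (p.2 i).1 (φ (p.2 i).1 - φ (p.2 i).2) +
        (V (p.2 i).1 (φ (p.2 i).2) - V (p.2 i).2 (φ (p.2 i).2)) := by
    rw [map_sub]; abel
  rw [dist_eq_norm, h5]
  refine (norm_add_le _ _).trans (add_le_add ?_ (h3.trans ?_))
  · rw [LinearIsometryEquiv.norm_map, dist_eq_norm]
  · have hB0 : 0 ≤ B := (norm_nonneg _).trans h4
    rw [Real.dist_eq, ← mul_sub, abs_mul, abs_of_nonneg (mul_nonneg hM0 hB0), mul_right_comm M B]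
    gcongr

end StrongFamilies

/-! ### Time cutoffs and convergence in `L²` -/

section Cutoff

variable {E : Type*} [NormedAddCommGroup E] [InnerProductSpace ℂ E]

/-- Dominated convergence in `L²`. -/
theorem TimeL2.tendsto_of_dominated {u : ℕ → TimeL2 E} {F : TimeL2 E} {h : ℝ → ℝ}
    (hh : MemLp h 2 volume) (hb : ∀ n, ∀ᵐ t : ℝ, ‖u n t - F t‖ ≤ h t)
    (hl : ∀ᵐ t : ℝ, Tendsto (fun n => u n t) atTop (𝓝 (F t))) : Tendsto u atTop (𝓝 F) := by
  have hsq : ∀ n, ‖u n - F‖ ^ 2 = ∫ t : ℝ, ‖u n t - F t‖ ^ 2 := by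
    intro n
    have h1 : ((‖u n - F‖ ^ 2 : ℝ) : ℂ) = ((∫ t : ℝ, ‖u n t - F t‖ ^ 2 : ℝ) : ℂ) := by
      rw [Complex.ofReal_pow, ← integral_complex_ofReal]
      have h2 := inner_self_eq_norm_sq_to_K (𝕜 := ℂ) (u n - F)
      rw [L2.inner_def] at h2
      refine h2.symm.trans (integral_congr_ae ?_)
      filter_upwards [Lp.coeFn_sub (u n) F] with t ht
      rw [ht, inner_self_eq_norm_sq_to_K]
      simp
    exact_mod_cast h1
  have hint : Tendsto (fun n => ∫ t : ℝ, ‖u n t - F t‖ ^ 2) atTop (𝓝 (∫ _ : ℝ, (0 : ℝ))) := by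
    refine tendsto_integral_of_dominated_convergence (fun t => h t ^ 2) (fun n => ?_)
      hh.integrable_sq (fun n => ?_) ?_
    · exact (((Lp.memLp (u n)).1.sub (Lp.memLp F).1).norm.pow 2)
    · filter_upwards [hb n] with t ht
      rw [Real.norm_of_nonneg (by positivity)]
      gcongr
    · filter_upwards [hl] with t ht
      have := ((ht.sub_const (F t)).norm).pow 2
      simpa using this
  rw [integral_zero] at hint
  rw [tendsto_iff_norm_sub_tendsto_zero]
  have h3 : Tendsto (fun n => √(‖u n - F‖ ^ 2)) atTop (𝓝 √0) :=
    (Real.continuous_sqrt.tendsto 0).comp (hint.congr fun n => (hsq n).symm)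
  simpa [Real.sqrt_sq] using h3

/-- A sequence of smooth cutoff functions exhausting the real line. -/
theorem exists_cutoff_sequence : ∃ (c : ℕ → ℝ → ℂ) (C : ℝ), 0 ≤ C ∧
    (∀ n, ContDiff ℝ 1 (c n)) ∧ (∀ n, HasCompactSupport (c n)) ∧ (∀ n t, ‖c n t‖ ≤ 1) ∧
    (∀ n t, ‖deriv (c n) t‖ ≤ C) ∧
    ∀ t, ∀ᶠ n in atTop, c n t = 1 ∧ deriv (c n) t = 0 := by
  let b : ContDiffBump (0 : ℝ) := ⟨1, 2, by norm_num, by norm_num⟩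
  let β : ℝ → ℂ := fun t => (b t : ℂ)
  have hβ : ContDiff ℝ 1 β := Complex.ofRealCLM.contDiff.comp b.contDiff
  have hβs : HasCompactSupport β :=
    b.hasCompactSupport.comp_left (g := fun x : ℝ => (x : ℂ)) Complex.ofReal_zero
  obtain ⟨C, hC⟩ := hβs.deriv.exists_bound_of_continuous (hβ.continuous_deriv_one)
  -- The chain-rule factor is at most `1`, so one bound on `β'` serves all `n`.
  have hd : ∀ n : ℕ, ∀ t, deriv (fun t => β ((n + 1 : ℝ)⁻¹ * t)) t =
      ((n + 1 : ℝ)⁻¹) • deriv β ((n + 1 : ℝ)⁻¹ * t) := fun n t => deriv_comp_mul_left _ _ _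
  refine ⟨fun n t => β ((n + 1 : ℝ)⁻¹ * t), C, (norm_nonneg _).trans (hC 0), fun n => ?_,
    fun n => ?_, fun n t => ?_, fun n t => ?_, fun t => ?_⟩
  · exact hβ.comp (by fun_prop)
  · exact hβs.comp_homeomorph (Homeomorph.mulLeft₀ ((n + 1 : ℝ)⁻¹) (by positivity))
  · simp only [β, Complex.norm_real, Real.norm_of_nonneg b.nonneg]
    exact b.le_one
  · rw [hd, norm_smul]
    refine (mul_le_of_le_one_left (norm_nonneg _) ?_).trans (hC _)
    rw [Real.norm_of_nonneg (by positivity)]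
    exact inv_le_one_of_one_le₀ (by linarith [n.cast_nonneg (α := ℝ)])
  · have hlim : Tendsto (fun n : ℕ => (n + 1 : ℝ)⁻¹ * t) atTop (𝓝 0) := by
      simpa using (tendsto_one_div_add_atTop_nhds_zero_nat (𝕜 := ℝ)).mul_const t
    -- Equality on a neighbourhood, not just at a point, is what makes the derivative vanish too.
    have hev : ∀ᶠ s : ℝ in 𝓝 0, β s = 1 := by
      filter_upwards [b.eventuallyEq_one] with s hs
      simp only [β, hs]
      simp
    refine (hlim.eventually (hev.eventually_nhds)).mono fun n hn => ⟨hn.self_of_nhds, ?_⟩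
    rw [hd, Filter.EventuallyEq.deriv_eq (f := fun _ => (1 : ℂ)) hn]
    simp

theorem memLp_smul_of_hasCompactSupport {c : ℝ → ℂ} (hc : Continuous c) (hs : HasCompactSupport c)
    (f : TimeL2 E) : MemLp (fun t => c t • f t) 2 volume := by
  obtain ⟨C, hC⟩ := hs.exists_bound_of_continuous hc
  refine MemLp.of_le_mul (Lp.memLp f) (c := C) (hc.aestronglyMeasurable.smul (Lp.memLp f).1) ?_
  filter_upwards with t
  rw [norm_smul]
  gcongr
  exact hC t

theorem LinearPMap.mem_graph_add {F : Type*} [AddCommGroup F] [Module ℂ F] {S T : F →ₗ.[ℂ] F}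
    {f g : F} : (f, g) ∈ (S + T).graph ↔
      ∃ p q, (f, p) ∈ S.graph ∧ (f, q) ∈ T.graph ∧ p + q = g := by
  constructor
  · intro h
    obtain ⟨x, rfl, rfl⟩ := (LinearPMap.mem_graph_iff _).1 h
    exact ⟨_, _, S.mem_graph ⟨x, x.2.1⟩, T.mem_graph ⟨x, x.2.2⟩, rfl⟩
  · rintro ⟨p, q, hp, hq, rfl⟩
    obtain ⟨x, hx, rfl⟩ := (LinearPMap.mem_graph_iff _).1 hp
    obtain ⟨⟨y, hyT⟩, hy, rfl⟩ := (LinearPMap.mem_graph_iff _).1 hq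
    simp only at hx hy
    subst hx hy
    exact (LinearPMap.mem_graph_iff _).2 ⟨⟨x, x.2, hyT⟩, rfl, rfl⟩

/-! ### The multiplication unitary and its action on graphs -/

variable {V : ℝ → E ≃ₗᵢ[ℂ] E}

/-- Multiplication by a strongly continuous family of unitary operators. -/
def strongMul (hV : ∀ ψ : E, Continuous fun t => V t ψ) : TimeL2 E ≃ₗᵢ[ℂ] TimeL2 E where
  toFun f := (memLp_strong hV (Lp.memLp f)).toLp _
  invFun f := (memLp_strong (continuous_symm_of_strong hV) (Lp.memLp f)).toLp _
  map_add' f g := by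
    rw [← MemLp.toLp_add, MemLp.toLp_eq_toLp_iff]
    filter_upwards [Lp.coeFn_add f g] with t ht
    simp only [ht, Pi.add_apply, map_add]
  map_smul' c f := by
    rw [RingHom.id_apply, ← MemLp.toLp_const_smul, MemLp.toLp_eq_toLp_iff]
    filter_upwards [Lp.coeFn_smul c f] with t ht
    simp only [ht, Pi.smul_apply, map_smul]
  left_inv f := by
    refine Lp.ext ?_
    filter_upwards [MemLp.coeFn_toLp (memLp_strong (continuous_symm_of_strong hV)
      (Lp.memLp ((memLp_strong hV (Lp.memLp f)).toLp _))),
      MemLp.coeFn_toLp (memLp_strong hV (Lp.memLp f))] with t h1 h2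
    rw [h1, h2, LinearIsometryEquiv.symm_apply_apply]
  right_inv f := by
    refine Lp.ext ?_
    filter_upwards [MemLp.coeFn_toLp (memLp_strong hV
      (Lp.memLp ((memLp_strong (continuous_symm_of_strong hV) (Lp.memLp f)).toLp _))),
      MemLp.coeFn_toLp (memLp_strong (continuous_symm_of_strong hV) (Lp.memLp f))] with t h1 h2
    rw [h1, h2, LinearIsometryEquiv.apply_symm_apply]
  norm_map' f := by
    change ‖(memLp_strong hV (Lp.memLp f)).toLp _‖ = ‖f‖
    rw [Lp.norm_toLp, Lp.norm_def]
    congr 1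
    exact eLpNorm_congr_norm_ae (Eventually.of_forall fun t => by simp)

theorem coeFn_strongMul (hV : ∀ ψ : E, Continuous fun t => V t ψ) (f : TimeL2 E) :
    strongMul hV f =ᵐ[volume] fun t => V t (f t) :=
  MemLp.coeFn_toLp (memLp_strong hV (Lp.memLp f))

/-- Cutting off in time and then multiplying by `V` maps the graph of `-i ∂ₜ + 𝔄` into the graph
of `-i ∂ₜ + 𝔅`, up to a commutator with the cutoff, if `B(t) V(t) = V(t) A(t) + i V̇(t)`. -/
theorem exists_mem_graph_cutoff [CompleteSpace E] (hV : StronglyC1 V) {A B : ℝ → E →ₗ.[ℂ] E}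
    (hAB : ∀ t x y, (x, y) ∈ (A t).graph →
      (V t x, V t y + Complex.I • strongDeriv V hV t x) ∈ (B t).graph)
    {f g : TimeL2 E} (hfg : (f, g) ∈ (momentum E + directIntegral A).graph)
    {c : ℝ → ℂ} (hc : ContDiff ℝ 1 c) (hcs : HasCompactSupport c) :
    ∃ u v : TimeL2 E, (u, v) ∈ (momentum E + directIntegral B).graph ∧
      (∀ᵐ t : ℝ, u t = V t (c t • f t)) ∧
      ∀ᵐ t : ℝ, v t = V t (c t • g t) - V t (Complex.I • deriv c t • f t) := by
  obtain ⟨p, q, hp, hq, rfl⟩ := LinearPMap.mem_graph_add.1 hfg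
  rw [momentum_graph] at hp
  rw [directIntegral_graph] at hq
  obtain ⟨φ, f', h1, h2, h3, h4⟩ := hp
  simp only at h1 h4
  have hVc := hV.continuous
  let ψ : ℝ → E := fun t => c t • φ t
  have hψ : LocallyAC ψ := fun a b =>
    (hc.contDiffOn.absolutelyContinuousOnInterval).smul (h2 a b)
  have hψs : HasCompactSupport ψ := hcs.smul_right
  -- Using the continuous representative and the cutoff, `V̇ψ` is continuous with compact support,
  -- hence in `L²`.
  let w : ℝ → E := fun t => strongDeriv V hV t (ψ t)
  have hwc : Continuous w := hV.continuous_eval_strongDeriv.comp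
    (continuous_id.prodMk hψ.continuous)
  have hws : HasCompactSupport w := hψs.mono fun t ht h => ht (by
    simp only [w]
    rw [h, map_zero])
  have hw : MemLp w 2 volume := hwc.memLp_of_hasCompactSupport hws
  have hcf := memLp_smul_of_hasCompactSupport hc.continuous hcs f
  have hcf' := memLp_smul_of_hasCompactSupport hc.continuous hcs f'
  have hcq := memLp_smul_of_hasCompactSupport hc.continuous hcs q
  have hdf := memLp_smul_of_hasCompactSupport (hc.continuous_deriv_one) hcs.deriv f
  let u : TimeL2 E := strongMul hVc hcf.toLp
  -- `d` is the derivative of `u`, and `r` is the direct integral of `B` applied to `u`; in `-i d +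
  -- r` the `w` terms cancel.
  let d : TimeL2 E := strongMul hVc (hcf'.toLp + hdf.toLp) + hw.toLp
  let r : TimeL2 E := strongMul hVc hcq.toLp + Complex.I • hw.toLp
  have hu : ∀ᵐ t : ℝ, u t = V t (c t • f t) := by
    filter_upwards [coeFn_strongMul hVc hcf.toLp, hcf.coeFn_toLp] with t e1 e2
    rw [e1, e2]
  have hd : ∀ᵐ t : ℝ, d t = V t (c t • f' t + deriv c t • f t) + w t := by
    filter_upwards [Lp.coeFn_add (strongMul hVc (hcf'.toLp + hdf.toLp)) hw.toLp,
      coeFn_strongMul hVc (hcf'.toLp + hdf.toLp), Lp.coeFn_add hcf'.toLp hdf.toLp,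
      hcf'.coeFn_toLp, hdf.coeFn_toLp, hw.coeFn_toLp] with t e1 e2 e3 e4 e5 e6
    simp only [d, e1, Pi.add_apply, e2, e3, e4, e5, e6]
  have hr : ∀ᵐ t : ℝ, r t = V t (c t • q t) + Complex.I • w t := by
    filter_upwards [Lp.coeFn_add (strongMul hVc hcq.toLp) (Complex.I • hw.toLp),
      coeFn_strongMul hVc hcq.toLp, hcq.coeFn_toLp, Lp.coeFn_smul Complex.I hw.toLp,
      hw.coeFn_toLp] with t e1 e2 e3 e4 e5
    simp only [r, e1, Pi.add_apply, e2, e3, e4, Pi.smul_apply, e5]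
  refine ⟨u, (-Complex.I) • d + r, LinearPMap.mem_graph_add.2 ⟨_, _, ?_, ?_, rfl⟩, hu, ?_⟩
  · rw [momentum_graph]
    refine ⟨fun t => V t (ψ t), d, ?_, hV.locallyAC_apply hψ, ?_, rfl⟩
    · filter_upwards [hu, h1] with t e1 e2
      simp only [e1, e2, ψ]
    · filter_upwards [hd, h1, h3] with t e1 e2 e3
      rw [e1, e2]
      have hct : HasDerivAt c (deriv c t) t := (hc.differentiable one_ne_zero t).hasDerivAt
      exact hasDerivAt_strong_apply hVc (hct.smul e3) (hV.hasDerivAt (ψ t) t)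
  · rw [directIntegral_graph]
    filter_upwards [hu, hr, hq, h1] with t e1 e2 e3 e4
    simp only [e1, e2]
    have := hAB t _ _ ((A t).graph.smul_mem (c t) e3)
    simp only [w, ψ, ← e4]
    exact this
  · filter_upwards [Lp.coeFn_add ((-Complex.I) • d) r, Lp.coeFn_smul (-Complex.I) d,
      hd, hr, Lp.coeFn_add p q, Lp.coeFn_smul (-Complex.I) f'] with t e1 e2 e3 e4 e5 e6
    have e7 : p t = (-Complex.I) • f' t := by rw [h4]; exact e6
    rw [e1, Pi.add_apply, e2, Pi.smul_apply, e3, e4, e5, Pi.add_apply, e7]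
    simp only [smul_add, map_add, map_smul, neg_smul, smul_neg, map_neg, smul_comm (c t)]
    abel

/-- At each fixed time the cut-off pair is eventually equal to the uncut one, and the commutator
term is dominated by `C‖f‖`, so dominated convergence removes the cutoff. -/
theorem strongMul_mem_closure_graph [CompleteSpace E] (hV : StronglyC1 V)
    {A B : ℝ → E →ₗ.[ℂ] E}
    (hAB : ∀ t x y, (x, y) ∈ (A t).graph →
      (V t x, V t y + Complex.I • strongDeriv V hV t x) ∈ (B t).graph)
    {f g : TimeL2 E} (hfg : (f, g) ∈ (momentum E + directIntegral A).graph) :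
    (strongMul hV.continuous f, strongMul hV.continuous g) ∈
      closure ((momentum E + directIntegral B).graph : Set (TimeL2 E × TimeL2 E)) := by
  obtain ⟨c, C, hC0, hc, hcs, hc1, hcd, hlim⟩ := exists_cutoff_sequence
  choose u v huv hu hv using fun n => exists_mem_graph_cutoff hV hAB hfg (hc n) (hcs n)
  have hf := coeFn_strongMul hV.continuous f
  have hg := coeFn_strongMul hV.continuous g
  refine mem_closure_of_tendsto (f := fun n => (u n, v n)) (b := atTop) ?_
    (Eventually.of_forall huv)
  have hsub : ∀ (t : ℝ) (n : ℕ) (x : E), ‖c n t • x - x‖ ≤ 2 * ‖x‖ := fun t n x => by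
    refine (norm_sub_le _ _).trans ?_
    rw [norm_smul]
    nlinarith [norm_nonneg x, hc1 n t]
  refine Tendsto.prodMk_nhds (TimeL2.tendsto_of_dominated (h := fun t => 2 * ‖f t‖) ?_ ?_ ?_)
    (TimeL2.tendsto_of_dominated (h := fun t => 2 * ‖g t‖ + C * ‖f t‖) ?_ ?_ ?_)
  · exact (Lp.memLp f).norm.const_mul 2
  · intro n
    filter_upwards [hu n, hf] with t e1 e2
    rw [e1, e2, ← map_sub, LinearIsometryEquiv.norm_map]
    exact hsub t n _
  · filter_upwards [ae_all_iff.2 hu, hf] with t e1 e2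
    refine tendsto_nhds_of_eventually_eq ?_
    filter_upwards [hlim t] with n hn
    rw [e1, e2, hn.1, one_smul]
  · exact ((Lp.memLp g).norm.const_mul 2).add ((Lp.memLp f).norm.const_mul C)
  · intro n
    filter_upwards [hv n, hg] with t e1 e2
    rw [e1, e2, ← map_sub, ← map_sub, LinearIsometryEquiv.norm_map, sub_right_comm]
    refine (norm_sub_le _ _).trans (add_le_add (hsub t n _) ?_)
    rw [norm_smul, norm_smul, Complex.norm_I, one_mul]
    gcongr
    exact hcd n t
  · filter_upwards [ae_all_iff.2 hv, hg] with t e1 e2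
    refine tendsto_nhds_of_eventually_eq ?_
    filter_upwards [hlim t] with n hn
    rw [e1, e2, hn.1, hn.2, one_smul, zero_smul, smul_zero, map_zero, sub_zero]

end Cutoff

/-! ### Self-adjointness of the transformed Hamiltonian -/

section Transformed

variable {E : Type*} [NormedAddCommGroup E] [InnerProductSpace ℂ E]

theorem LinearPMap.mem_graph_vadd {F : Type*} [AddCommGroup F] [Module ℂ F] {S : F →ₗ[ℂ] F}
    {A : F →ₗ.[ℂ] F} {x y : F} : (x, y) ∈ (S +ᵥ A).graph ↔ (x, y - S x) ∈ A.graph := by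
  constructor
  · intro h
    obtain ⟨z, rfl, rfl⟩ := (LinearPMap.mem_graph_iff _).1 h
    exact (LinearPMap.mem_graph_iff _).2 ⟨⟨z, z.2⟩, rfl, by simp⟩
  · intro h
    obtain ⟨z, rfl, hz⟩ := (LinearPMap.mem_graph_iff _).1 h
    refine (LinearPMap.mem_graph_iff _).2 ⟨⟨z, z.2⟩, rfl, ?_⟩
    refine (LinearPMap.vadd_apply S A z).trans ?_
    rw [hz]
    simp

theorem mem_graph_unitaryConj {V : E ≃ₗᵢ[ℂ] E} {A : E →ₗ.[ℂ] E} {x y : E} :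
    (x, y) ∈ (unitaryConj V A).graph ↔ (V.symm x, V.symm y) ∈ A.graph := by
  constructor
  · intro h
    obtain ⟨z, rfl, rfl⟩ := (LinearPMap.mem_graph_iff _).1 h
    exact (LinearPMap.mem_graph_iff _).2 ⟨⟨V.symm z, z.2⟩, rfl, (V.symm_apply_apply _).symm⟩
  · intro h
    obtain ⟨z, hz, hAz⟩ := (LinearPMap.mem_graph_iff _).1 h
    simp only at hz hAz
    have hx : V.symm x ∈ A.domain := hz ▸ z.2
    refine (LinearPMap.mem_graph_iff _).2 ⟨⟨x, hx⟩, rfl, ?_⟩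
    change V (A ⟨V.symm x, hx⟩) = y
    rw [← Subtype.ext (a1 := z) (a2 := ⟨V.symm x, hx⟩) hz, hAz, V.apply_symm_apply]

variable {V : ℝ → E ≃ₗᵢ[ℂ] E}

theorem mem_graph_transformedHamiltonian {hV : StronglyC1 V} {A : ℝ → E →ₗ.[ℂ] E} {t : ℝ}
    {x y : E} : (x, y) ∈ (transformedHamiltonian V hV A t).graph ↔
      ((V t).symm x, (V t).symm (y - Complex.I • strongDeriv V hV t ((V t).symm x))) ∈
        (A t).graph :=
  LinearPMap.mem_graph_vadd.trans mem_graph_unitaryConj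

/-- Differentiate the constant function `⟨V_t x, V_t y⟩`. This is the symmetry of `iV̇V⁻¹`. -/
theorem StronglyC1.inner_strongDeriv (hV : StronglyC1 V) (t : ℝ) (x y : E) :
    inner ℂ (V t x) (strongDeriv V hV t y) = -inner ℂ (strongDeriv V hV t x) (V t y) := by
  have h1 := (hV.hasDerivAt x t).inner ℂ (hV.hasDerivAt y t)
  simp only [LinearIsometryEquiv.inner_map_map] at h1
  exact eq_neg_of_add_eq_zero_left (h1.unique (hasDerivAt_const t _))

/-- The transformed Hamiltonian is self-adjoint: a bounded symmetric perturbation of a unitary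
conjugate of a self-adjoint operator. -/
theorem isSelfAdjoint_transformedHamiltonian [CompleteSpace E] (hV : StronglyC1 V)
    {A : ℝ → E →ₗ.[ℂ] E} {t : ℝ} (hA : IsSelfAdjoint (A t)) :
    IsSelfAdjoint (transformedHamiltonian V hV A t) := by
  set B := transformedHamiltonian V hV A t with hB
  have hBd : Dense (B.domain : Set E) := by
    have h : (B.domain : Set E) = (V t).symm ⁻¹' ((A t).domain : Set E) := rfl
    rw [h]
    exact hA.dense_domain.preimage (V t).symm.toHomeomorph.isOpenMap
  have hAg : (A t).graph.adjoint = (A t).graph := by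
    rw [← LinearPMap.adjoint_graph_eq_graph_adjoint hA.dense_domain,
      LinearPMap.isSelfAdjoint_def.1 hA]
  rw [LinearPMap.isSelfAdjoint_def]
  refine LinearPMap.eq_of_eq_graph ?_
  rw [LinearPMap.adjoint_graph_eq_graph_adjoint hBd]
  ext ⟨x, y⟩
  rw [hB, mem_graph_transformedHamiltonian, ← hAg, Submodule.mem_adjoint_iff,
    Submodule.mem_adjoint_iff]
  -- The map `(a, b) ↦ (Va, Vb + iV̇a)` identifies the graph of `A t` with that of `B` and carries
  -- one adjoint condition to the other.
  have key : ∀ a b : E, inner ℂ (V t b + Complex.I • strongDeriv V hV t a) x -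
      inner ℂ (V t a) y = inner ℂ b ((V t).symm x) - inner ℂ a ((V t).symm
        (y - Complex.I • strongDeriv V hV t ((V t).symm x))) := by
    intro a b
    obtain ⟨z, rfl⟩ := (V t).surjective x
    rw [← (V t).inner_map_map a, (V t).apply_symm_apply, (V t).symm_apply_apply, inner_add_left,
      (V t).inner_map_map, inner_sub_right, inner_smul_left, inner_smul_right,
      hV.inner_strongDeriv, Complex.conj_I]
    ring
  constructor
  · intro h a b hab
    rw [← key]
    refine h _ _ (mem_graph_transformedHamiltonian.2 ?_)
    simpa using hab
  · intro h a b hab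
    have := key ((V t).symm a) ((V t).symm
      (b - Complex.I • strongDeriv V hV t ((V t).symm a)))
    rw [h _ _ (mem_graph_transformedHamiltonian.1 hab)] at this
    simpa using this

end Transformed

/-! ### Quasi-energy operators under conjugation, and transport of weak association -/

section QuasiEnergyTransform

variable {E : Type*} [NormedAddCommGroup E] [InnerProductSpace ℂ E]

theorem mem_graph_stoneGenerator {F : Type*} [NormedAddCommGroup F] [InnerProductSpace ℂ F]
    {T : ℝ → F →ₗ[ℂ] F} {f g : F} : (f, g) ∈ (stoneGenerator T).graph ↔
      HasDerivAt (fun σ => T σ f) (-Complex.I • g) 0 := by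
  constructor
  · intro h
    obtain ⟨x, rfl, rfl⟩ := (LinearPMap.mem_graph_iff _).1 h
    have h1 : DifferentiableAt ℝ (fun σ => T σ (x : F)) 0 := x.2
    have h2 : -Complex.I • stoneGenerator T x = deriv (fun σ => T σ (x : F)) 0 := by
      change -Complex.I • Complex.I • deriv (fun σ => T σ (x : F)) 0 = _
      rw [smul_smul]
      simp
    simp only [h2]
    exact h1.hasDerivAt
  · intro h
    refine (LinearPMap.mem_graph_iff _).2 ⟨⟨f, h.differentiableAt⟩, rfl, ?_⟩
    change Complex.I • deriv (fun σ => T σ f) 0 = g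
    rw [h.deriv, smul_smul]
    simp

/-- The generator of a family of isometries starting at the identity is symmetric. -/
theorem isFormalAdjoint_stoneGenerator {F : Type*} [NormedAddCommGroup F] [InnerProductSpace ℂ F]
    {T : ℝ → F →ₗ[ℂ] F} (hT : ∀ σ f, ‖T σ f‖ = ‖f‖) (h0 : ∀ f, T 0 f = f) :
    (stoneGenerator T).IsFormalAdjoint (stoneGenerator T) := by
  intro x y
  have hx := mem_graph_stoneGenerator.1 ((stoneGenerator T).mem_graph x)
  have hy := mem_graph_stoneGenerator.1 ((stoneGenerator T).mem_graph y)
  have h := hx.inner ℂ hy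
  have hinner : ∀ σ (f g : F), inner ℂ (T σ f) (T σ g) = inner ℂ f g := fun σ =>
    (⟨T σ, hT σ⟩ : F →ₗᵢ[ℂ] F).inner_map_map
  -- The differentiated inner product becomes constant in `σ`, so its derivative vanishes.
  simp only [hinner, h0] at h
  have h1 := h.unique (hasDerivAt_const _ _)
  rw [inner_smul_left, inner_smul_right, map_neg, Complex.conj_I] at h1
  have h2 : Complex.I * (inner ℂ (stoneGenerator T x) (y : F) -
      inner ℂ (x : F) (stoneGenerator T y)) = 0 := by
    linear_combination h1
  exact sub_eq_zero.1 ((mul_eq_zero.1 h2).resolve_left Complex.I_ne_zero)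

theorem Propagator.op_self (U : Propagator E) (t : ℝ) (ψ : E) : U.op t t ψ = ψ :=
  (U.op t t).injective (U.chapman t t t ψ)

theorem Propagator.coeFn_evolutionGroup (U : Propagator E) (σ : ℝ) (f : TimeL2 E) :
    U.evolutionGroup σ f =ᵐ[volume] fun t => U.op t (t - σ) (f (t - σ)) :=
  (U.memLp_shift σ f).coeFn_toLp

theorem Propagator.norm_evolutionGroup (U : Propagator E) (σ : ℝ) (f : TimeL2 E) :
    ‖U.evolutionGroup σ f‖ = ‖f‖ := by
  change ‖(U.memLp_shift σ f).toLp _‖ = ‖f‖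
  rw [Lp.norm_toLp, Lp.norm_def,
    ← eLpNorm_comp_measurePreserving (Lp.memLp f).1 (measurePreserving_sub_right volume σ)]
  congr 1
  exact eLpNorm_congr_norm_ae (Eventually.of_forall fun t => by simp)

theorem Propagator.evolutionGroup_zero (U : Propagator E) (f : TimeL2 E) :
    U.evolutionGroup 0 f = f := by
  refine Lp.ext ?_
  filter_upwards [U.coeFn_evolutionGroup 0 f] with t ht
  rw [ht, sub_zero, U.op_self]

/-- A densely defined symmetric operator is contained in its adjoint, which is closed. -/
theorem Propagator.isClosable_quasiEnergy [CompleteSpace E] (U : Propagator E)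
    (hd : Dense (U.quasiEnergy.domain : Set (TimeL2 E))) : U.quasiEnergy.IsClosable :=
  LinearPMap.isClosable_iff_exists_closed_extension.2 ⟨_, LinearPMap.adjoint_isClosed hd,
    (isFormalAdjoint_stoneGenerator U.norm_evolutionGroup U.evolutionGroup_zero).le_adjoint hd⟩

/-- The propagator `V(t) U(t,s) V(s)⁻¹`. -/
def Propagator.conj (U : Propagator E) {V : ℝ → E ≃ₗᵢ[ℂ] E}
    (hV : ∀ ψ : E, Continuous fun t => V t ψ) : Propagator E where
  op t s := ((V s).symm.trans (U.op t s)).trans (V t)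
  continuous_op ψ := by
    have h1 : Continuous fun p : ℝ × ℝ => (V p.2).symm ψ :=
      (continuous_symm_of_strong hV ψ).comp continuous_snd
    have h2 := (continuous_eval_of_strong (W := fun p : ℝ × ℝ => U.op p.1 p.2)
      U.continuous_op).comp (continuous_id.prodMk h1)
    exact (continuous_eval_of_strong hV).comp (continuous_fst.prodMk h2)
  chapman t s r ψ := by simp [U.chapman]

/-- The factor `V(t-σ)⁻¹` of the conjugated propagator meets the shifted `V(t-σ)` and cancels. -/
theorem Propagator.evolutionGroup_conj (U : Propagator E) {V : ℝ → E ≃ₗᵢ[ℂ] E}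
    (hV : ∀ ψ : E, Continuous fun t => V t ψ) (σ : ℝ) (f : TimeL2 E) :
    (U.conj hV).evolutionGroup σ (strongMul hV f) = strongMul hV (U.evolutionGroup σ f) := by
  refine Lp.ext ?_
  filter_upwards [(U.conj hV).coeFn_evolutionGroup σ (strongMul hV f),
    coeFn_strongMul hV (U.evolutionGroup σ f), U.coeFn_evolutionGroup σ f,
    (measurePreserving_sub_right (volume : Measure ℝ) σ).quasiMeasurePreserving.ae_eq
      (coeFn_strongMul hV f)] with t h1 h2 h3 h4
  simp only [Function.comp_apply] at h4
  rw [h1, h2, h3, h4]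
  simp [Propagator.conj]

theorem LinearIsometryEquiv.hasDerivAt_comp_iff {F : Type*} [NormedAddCommGroup F]
    [InnerProductSpace ℂ F] (M : F ≃ₗᵢ[ℂ] F) {φ : ℝ → F} {φ' : F} {t : ℝ} :
    HasDerivAt (fun s => M (φ s)) (M φ') t ↔ HasDerivAt φ φ' t := by
  have h : ∀ (N : F ≃ₗᵢ[ℂ] F) {φ : ℝ → F} {φ' : F}, HasDerivAt φ φ' t →
      HasDerivAt (fun s => N (φ s)) (N φ') t := fun N _ _ h =>
    ((N.toContinuousLinearEquiv : F →L[ℂ] F).restrictScalars ℝ).hasFDerivAt.comp_hasDerivAt t h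
  exact ⟨fun h1 => by simpa using h M.symm h1, h M⟩

theorem Propagator.mem_graph_quasiEnergy_conj (U : Propagator E) {V : ℝ → E ≃ₗᵢ[ℂ] E}
    (hV : ∀ ψ : E, Continuous fun t => V t ψ) {f g : TimeL2 E} :
    (strongMul hV f, strongMul hV g) ∈ (U.conj hV).quasiEnergy.graph ↔
      (f, g) ∈ U.quasiEnergy.graph := by
  refine mem_graph_stoneGenerator.trans (Iff.trans ?_ mem_graph_stoneGenerator.symm)
  simp only [U.evolutionGroup_conj hV, ← map_smul]
  exact (strongMul hV).hasDerivAt_comp_iff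

/-- Weak association is transported along `U ↦ V U V⁻¹`, `A ↦ V A V⁻¹ + i V̇ V⁻¹`. -/
theorem WeaklyAssociated.conj [CompleteSpace E] {U : Propagator E} {A : ℝ → E →ₗ.[ℂ] E}
    (hU : WeaklyAssociated U A) {V : ℝ → E ≃ₗᵢ[ℂ] E} (hV : StronglyC1 V) :
    WeaklyAssociated (U.conj hV.continuous) (transformedHamiltonian V hV A) := by
  obtain ⟨hd, hK⟩ := hU
  set B := transformedHamiltonian V hV A
  set S := momentum E + directIntegral A
  set R := momentum E + directIntegral B
  set M := strongMul hV.continuous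
  have hS : S ≤ U.quasiEnergy := hK ▸ S.le_closure
  have hgraph : (U.quasiEnergy.graph : Set (TimeL2 E × TimeL2 E)) = closure S.graph := by
    -- `LinearPMap.closure` describes the closure of the graph only for closable operators; `S`
    -- inherits closability from its extension `K`.
    have hcl := (U.isClosable_quasiEnergy (hd.mono hS.1)).leIsClosable hS
    rw [hK, ← hcl.graph_closure_eq_closure_graph]
    rfl
  have hAB : ∀ t x y, (x, y) ∈ (A t).graph →
      (V t x, V t y + Complex.I • strongDeriv V hV t x) ∈ (B t).graph := by
    intro t x y h
    refine mem_graph_transformedHamiltonian.2 ?_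
    simpa using h
  have hBA : ∀ t x y, (x, y) ∈ (B t).graph → ((V t).symm x,
      (V t).symm y + Complex.I • strongDeriv (fun t => (V t).symm) hV.symm t x) ∈
        (A t).graph := by
    intro t x y h
    have := mem_graph_transformedHamiltonian.1 h
    rw [hV.strongDeriv_symm]
    simpa [sub_eq_add_neg] using this
  have hRK : closure (R.graph : Set (TimeL2 E × TimeL2 E)) =
      (U.conj hV.continuous).quasiEnergy.graph := by
    ext ⟨a, b⟩
    obtain ⟨f, rfl⟩ := M.surjective a
    obtain ⟨g, rfl⟩ := M.surjective b
    rw [SetLike.mem_coe, U.mem_graph_quasiEnergy_conj, ← SetLike.mem_coe, hgraph]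
    constructor
    · intro h
      have hmaps : Set.MapsTo (fun p : TimeL2 E × TimeL2 E => (M.symm p.1, M.symm p.2))
          R.graph (closure S.graph) := fun p hp =>
        strongMul_mem_closure_graph hV.symm hBA hp
      simpa using hmaps.closure_left (by fun_prop) isClosed_closure h
    · intro h
      have hmaps : Set.MapsTo (fun p : TimeL2 E × TimeL2 E => (M p.1, M p.2))
          S.graph (closure R.graph) := fun p hp => strongMul_mem_closure_graph hV hAB hp
      exact hmaps.closure_left (by fun_prop) isClosed_closure h
  refine ⟨?_, ?_⟩
  · have hsub : M '' S.domain ⊆ closure (R.domain : Set (TimeL2 E)) := by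
      rintro _ ⟨f, hf, rfl⟩
      have h := strongMul_mem_closure_graph hV hAB (S.mem_graph ⟨f, hf⟩)
      have hmaps : Set.MapsTo Prod.fst (R.graph : Set (TimeL2 E × TimeL2 E)) R.domain :=
        fun p hp => LinearPMap.mem_domain_of_mem_graph hp
      exact hmaps.closure continuous_fst h
    exact dense_closure.1 ((M.surjective.denseRange.dense_image M.continuous hd).mono hsub)
  · have hcl : R.graph.topologicalClosure = (U.conj hV.continuous).quasiEnergy.graph :=
      SetLike.coe_injective hRK
    -- The closed graph of `R` is the graph of an operator, which is closability.
    have hR : R.IsClosable := ⟨_, hcl⟩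
    exact LinearPMap.eq_of_eq_graph (hcl.symm.trans hR.graph_closure_eq_closure_graph)

end QuasiEnergyTransform

end

theorem mainTheorem8 {E : Type*} [NormedAddCommGroup E] [InnerProductSpace ℂ E]
    [CompleteSpace E] [TopologicalSpace.SeparableSpace E]
    (V : ℝ → E ≃ₗᵢ[ℂ] E) (hV : StronglyC1 V)
    (D : Submodule ℂ E) (Htilde : ℝ → E →ₗ.[ℂ] E)
    (hsa : ∀ t, IsSelfAdjoint (Htilde t)) (hdom : ∀ t, (Htilde t).domain = D)
    (Utilde : Propagator E) (hU : WeaklyAssociated Utilde Htilde) :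
    (∀ t, IsSelfAdjoint (transformedHamiltonian V hV Htilde t)) ∧
    ∃ U : Propagator E,
      (∀ t s, U.op t s = ((V s).symm.trans (Utilde.op t s)).trans (V t)) ∧
      WeaklyAssociated U (transformedHamiltonian V hV Htilde) :=
  ⟨fun t => isSelfAdjoint_transformedHamiltonian hV (hsa t),
    Utilde.conj hV.continuous, fun _ _ => rfl, hU.conj hV⟩
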